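/- \textbf{Inverse theorem for the $U^3$-norm on $\mathbb{F}_5^n$.} For every real $\delta > 0$ there is a constant $c = c(\delta) > 0$, depending only on $\delta$, such that the following holds for every integer $n \geq 0$. Let $G := \mathbb{F}_5^n$, let $\omega := e^{2\pi i/5}$, and write $\mathbb{E}_{x \in X} := |X|^{-1}\sum_{x \in X}$ for the average over a finite set $X$. Let $f : G \to [-1,1]$ be a function with $\Vert f \Vert_{U^3} \geq \delta$, where the Gowers $U^3$-norm $\Vert f \Vert_{U^3} \geq 0$ is defined by \[ \Vert f \Vert_{U^3}^8 := \mathbb{E}_{x,h_1,h_2,h_3 \in G}\, f(x)f(x+h_1)f(x+h_2)f(x+h_3)f(x+h_1+h_2)f(x+h_1+h_3)f(x+h_2+h_3)f(x+h_1+h_2+h_3). \] Then there are an $n \times n$ matrix $M$ over $\mathbb{F}_5$ and a vector $r \in \mathbb{F}_5^n$ such that \[ \bigl|\mathbb{E}_{x \in G}\, f(x)\,\omega^{x^T M x + r^T x}\bigr| \geq c. \] -/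

import Mathlib

open scoped BigOperators Matrix

/-- The average of `f(x) f(x+h₁) f(x+h₂) f(x+h₃) f(x+h₁+h₂) f(x+h₁+h₃) f(x+h₂+h₃) f(x+h₁+h₂+h₃)`
over all `h₁, h₂, h₃, x` in the finite abelian group `G`. -/
noncomputable def cubeAverage {G : Type*} [AddCommGroup G] [Fintype G] (f : G → ℝ) : ℝ :=
  𝔼 h₁ : G, 𝔼 h₂ : G, 𝔼 h₃ : G, 𝔼 x : G,
    f x * f (x + h₁) * f (x + h₂) * f (x + h₃) *
      f (x + h₁ + h₂) * f (x + h₁ + h₃) * f (x + h₂ + h₃) * f (x + h₁ + h₂ + h₃)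

/-- The Gowers `U³`-norm of a real-valued function: the eighth root of the cube average. -/
noncomputable def gowersU3Norm {G : Type*} [AddCommGroup G] [Fintype G] (f : G → ℝ) : ℝ :=
  cubeAverage f ^ (1 / 8 : ℝ)

/-- The cube average is non-negative, so that its eighth root is a genuine one. -/
theorem cubeAverage_nonneg {G : Type*} [AddCommGroup G] [Fintype G] (f : G → ℝ) :
    0 ≤ cubeAverage f := by
  unfold cubeAverage
  refine Finset.expect_nonneg fun h₁ _ => Finset.expect_nonneg fun h₂ _ => ?_
  set F : G → ℝ := fun x => f x * f (x + h₁) * f (x + h₂) * f (x + h₁ + h₂) with hF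
  have key : (𝔼 h₃ : G, 𝔼 x : G,
      f x * f (x + h₁) * f (x + h₂) * f (x + h₃) *
      f (x + h₁ + h₂) * f (x + h₁ + h₃) * f (x + h₂ + h₃) * f (x + h₁ + h₂ + h₃)) =
      (𝔼 x : G, F x) * 𝔼 y : G, F y := by
    rw [Finset.expect_comm, Finset.expect_mul]
    refine Finset.expect_congr rfl fun x _ => ?_
    rw [Finset.mul_expect]
    refine Fintype.expect_equiv (Equiv.addLeft x) _ _ fun h₃ => ?_
    simp only [hF, Equiv.coe_addLeft]
    rw [add_right_comm x h₁ h₃, add_right_comm x h₂ h₃, add_right_comm (x + h₁) h₂ h₃,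
      add_right_comm x h₁ h₃]
    ring
  rw [key]
  exact mul_self_nonneg _

theorem gowersU3Norm_pow_eight {G : Type*} [AddCommGroup G] [Fintype G] (f : G → ℝ) :
    gowersU3Norm f ^ 8 = cubeAverage f := by
  unfold gowersU3Norm
  rw [← Real.rpow_natCast, ← Real.rpow_mul (cubeAverage_nonneg f)]
  norm_num

/-- The quadratic phase `x ↦ ω ^ (xᵀ M x + rᵀ x)` on `𝔽₅ⁿ`, where `ω = exp (2πi/5)`:
`ZMod.stdAddChar j = exp (2πi j / 5)` for `j` in `ZMod 5`. -/
noncomputable def quadraticPhase {n : ℕ} (M : Matrix (Fin n) (Fin n) (ZMod 5))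
    (r : Fin n → ZMod 5) (x : Fin n → ZMod 5) : ℂ :=
  ZMod.stdAddChar (x ⬝ᵥ (M *ᵥ x) + r ⬝ᵥ x)

/-!
If the `U³`-norm of `f` is large, then for a positive proportion of `h` the multiplicative
derivative `Δₕ f` correlates with a character `φ h`. Writing the sum of these correlations in
terms of the second derivatives of `f` and taking Fourier transforms in `h` shows that the graph
of `φ` has large additive energy, so by the Balog–Szemerédi–Gowers and Freiman theorems `φ` agrees
on a positive proportion with an affine map `h ↦ M h + b`. The bicharacter `M` is nearly
symmetric: since `(h, k) ↦ M h k` correlates with a product of functions of `h`, of `k` and of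
`h + k`, a Cauchy–Schwarz step that exchanges the variables, followed by Parseval, bounds the size
of the range of `Mᵀ - M`. Splitting `M` into `S = (M + Mᵀ) / 2` and half of `M - Mᵀ` and
pigeonholing over the few values of the latter replaces `M` by `S`. A symmetric bicharacter
integrates, again because two is invertible: `x ↦ (S / 2) x x` has second derivative `S h k`.
Twisting `f` by this quadratic phase makes its `U²`-norm large, and hence one of its Fourier
coefficients.
-/

open Finset
open scoped ComplexConjugate Pointwise Combinatorics.Additive

section Expect

variable {α : Type*} [Fintype α]

lemma expect_comp_add_right {M G : Type*} [AddCommMonoid M] [Module ℚ≥0 M] [AddGroup G]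
    [Fintype G] (f : G → M) (a : G) : 𝔼 x, f (x + a) = 𝔼 x, f x :=
  Fintype.expect_equiv (Equiv.addRight a) _ _ fun _ => rfl

variable [Nonempty α]

lemma norm_expect_pow_le (f : α → ℂ) (n : ℕ) : ‖𝔼 x, f x‖ ^ n ≤ 𝔼 x, ‖f x‖ ^ n := by
  have hmean := Real.pow_arith_mean_le_arith_mean_pow univ (fun _ : α => (Fintype.card α : ℝ)⁻¹)
    (fun x => ‖f x‖) (fun _ _ => by positivity) (by simp) (fun _ _ => norm_nonneg _) n
  simp_rw [← mul_sum, ← smul_eq_mul] at hmean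
  calc ‖𝔼 x, f x‖ ^ n ≤ (𝔼 x, ‖f x‖) ^ n := by gcongr; exact RCLike.norm_expect_le (K := ℂ)
    _ ≤ 𝔼 x, ‖f x‖ ^ n := by
      simpa only [Fintype.expect_eq_sum_div_card, div_eq_inv_mul, smul_eq_mul] using hmean

lemma norm_expect_mul_sq_le {p : α → ℂ} (hp : ∀ x, ‖p x‖ ≤ 1) (F : α → ℂ) :
    ‖𝔼 x, p x * F x‖ ^ 2 ≤ 𝔼 x, ‖F x‖ ^ 2 := by
  refine (norm_expect_pow_le _ 2).trans (expect_le_expect fun x _ => ?_)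
  rw [norm_mul]
  gcongr
  exact mul_le_of_le_one_left (norm_nonneg _) (hp x)

end Expect

section Fourier

variable {G : Type*} [AddCommGroup G] [Fintype G]

/-- The Fourier coefficient of `f` at the character `ψ`, normalised by averaging over `G`, so that
`f` is the sum of its coefficients times the corresponding characters. -/
noncomputable def charCoeff (f : G → ℂ) (ψ : AddChar G ℂ) : ℂ := 𝔼 x, f x * conj (ψ x)

lemma charCoeff_neg (f : G → ℂ) (ψ : AddChar G ℂ) : charCoeff f (-ψ) = 𝔼 x, f x * ψ x := by
  simp_rw [charCoeff, AddChar.neg_apply, ← AddChar.map_neg_eq_conj, neg_neg]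

lemma norm_charCoeff_le_one {f : G → ℂ} (hf : ∀ x, ‖f x‖ ≤ 1) (ψ : AddChar G ℂ) :
    ‖charCoeff f ψ‖ ≤ 1 :=
  (RCLike.norm_expect_le (K := ℂ)).trans <| expect_le univ_nonempty fun x _ => by
    simpa using hf x

lemma norm_charCoeff_comp_add_left (f : G → ℂ) (a : G) (ψ : AddChar G ℂ) :
    ‖charCoeff (fun x => f (a + x)) ψ‖ = ‖charCoeff f ψ‖ := by
  have htranslate : charCoeff f ψ = conj (ψ a) * charCoeff (fun x => f (a + x)) ψ := by
    rw [charCoeff, charCoeff, mul_expect]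
    refine (Fintype.expect_equiv (Equiv.addLeft a) _ _ fun x => ?_).symm
    rw [Equiv.coe_addLeft, AddChar.map_add_eq_mul, map_mul, mul_left_comm]
  rw [htranslate, norm_mul, RCLike.norm_conj, AddChar.norm_apply, one_mul]

lemma sum_charCoeff_mul (f : G → ℂ) (x : G) : ∑ ψ, charCoeff f ψ * ψ x = f x := by
  classical
  calc ∑ ψ, charCoeff f ψ * ψ x = 𝔼 y, f y * ∑ ψ : AddChar G ℂ, ψ (x - y) := by
        simp_rw [charCoeff, expect_mul, ← expect_sum_comm, mul_sum, sub_eq_neg_add,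
          AddChar.map_add_eq_mul, AddChar.map_neg_eq_conj, mul_assoc]
    _ = f x := by
        rw [Fintype.expect_eq_sum_div_card]
        simp [AddChar.sum_apply_eq_ite, sub_eq_zero]

lemma sum_norm_sq_charCoeff (f : G → ℂ) : ∑ ψ, ‖charCoeff f ψ‖ ^ 2 = 𝔼 x, ‖f x‖ ^ 2 := by
  have hcomplex : ∑ ψ, charCoeff f ψ * conj (charCoeff f ψ) = 𝔼 x, f x * conj (f x) := by
    calc ∑ ψ, charCoeff f ψ * conj (charCoeff f ψ)
        = 𝔼 x, f x * conj (∑ ψ, charCoeff f ψ * ψ x) := by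
          simp_rw [map_sum, map_mul, mul_sum, expect_sum_comm]
          refine sum_congr rfl fun ψ _ => ?_
          rw [charCoeff, expect_mul]
          exact expect_congr rfl fun x _ => by ring
      _ = 𝔼 x, f x * conj (f x) := by simp_rw [sum_charCoeff_mul]
  simp_rw [Complex.mul_conj'] at hcomplex
  exact_mod_cast hcomplex

lemma sum_norm_sq_charCoeff_le_one {f : G → ℂ} (hf : ∀ x, ‖f x‖ ≤ 1) :
    ∑ ψ, ‖charCoeff f ψ‖ ^ 2 ≤ 1 := by
  rw [sum_norm_sq_charCoeff]
  exact expect_le univ_nonempty fun x _ => pow_le_one₀ (norm_nonneg _) (hf x)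

lemma expect_mul_mul_comp_add (a b c : G → ℂ) :
    𝔼 x, 𝔼 y, a x * b y * c (x + y) =
      ∑ ψ, charCoeff a (-ψ) * charCoeff b (-ψ) * charCoeff c ψ := by
  simp_rw [← sum_charCoeff_mul c, mul_sum, expect_sum_comm]
  refine sum_congr rfl fun ψ _ => ?_
  rw [charCoeff_neg, charCoeff_neg, expect_mul_expect, expect_mul]
  simp_rw [expect_mul, AddChar.map_add_eq_mul]
  exact expect_congr rfl fun x _ => expect_congr rfl fun y _ => by ring

lemma norm_expect_mul_mul_comp_add_le {a b c : G → ℂ} (ha : ∀ x, ‖a x‖ ≤ 1)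
    (hb : ∀ x, ‖b x‖ ≤ 1) {η : ℝ} (hc : ∀ ψ, ‖charCoeff c ψ‖ ≤ η) :
    ‖𝔼 x, 𝔼 y, a x * b y * c (x + y)‖ ≤ η := by
  have hη : 0 ≤ η := (norm_nonneg _).trans (hc 0)
  have hparseval {g : G → ℂ} (hg : ∀ x, ‖g x‖ ≤ 1) : ∑ ψ, ‖charCoeff g (-ψ)‖ ^ 2 ≤ 1 :=
    (Fintype.sum_equiv (Equiv.neg _) _ (fun ψ => ‖charCoeff g ψ‖ ^ 2) fun _ => rfl).trans_le
      (sum_norm_sq_charCoeff_le_one hg)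
  calc ‖𝔼 x, 𝔼 y, a x * b y * c (x + y)‖
      ≤ ∑ ψ, ‖charCoeff a (-ψ)‖ * ‖charCoeff b (-ψ)‖ * ‖charCoeff c ψ‖ := by
        rw [expect_mul_mul_comp_add]
        exact norm_sum_le_of_le _ fun ψ _ => by rw [norm_mul, norm_mul]
    _ ≤ ∑ ψ, (‖charCoeff a (-ψ)‖ ^ 2 + ‖charCoeff b (-ψ)‖ ^ 2) / 2 * η := by
        gcongr with ψ
        · linarith [two_mul_le_add_sq ‖charCoeff a (-ψ)‖ ‖charCoeff b (-ψ)‖]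
        · exact hc ψ
    _ = (∑ ψ, ‖charCoeff a (-ψ)‖ ^ 2 + ∑ ψ, ‖charCoeff b (-ψ)‖ ^ 2) / 2 * η := by
        rw [← sum_mul, ← sum_div, sum_add_distrib]
    _ ≤ (1 + 1) / 2 * η := by gcongr <;> apply hparseval <;> assumption
    _ = η := by ring

/-- The inverse theorem for the `U²`-norm. -/
lemma exists_norm_box_le_norm_charCoeff {g₁ g₂ g₃ : G → ℂ} (g₄ : G → ℂ)
    (h₁ : ∀ x, ‖g₁ x‖ ≤ 1) (h₂ : ∀ x, ‖g₂ x‖ ≤ 1) (h₃ : ∀ x, ‖g₃ x‖ ≤ 1) :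
    ∃ ψ, ‖𝔼 x, 𝔼 h, 𝔼 k, g₁ x * g₂ (x + h) * g₃ (x + k) * g₄ (x + h + k)‖ ≤
      ‖charCoeff g₄ ψ‖ := by
  obtain ⟨ψ, hψ⟩ := Finite.exists_max fun ψ => ‖charCoeff g₄ ψ‖
  refine ⟨ψ, (RCLike.norm_expect_le (K := ℂ)).trans <| expect_le univ_nonempty fun x _ => ?_⟩
  simp_rw [mul_assoc (g₁ x), ← mul_expect, add_assoc x]
  rw [norm_mul]
  refine (mul_le_of_le_one_left (norm_nonneg _) (h₁ x)).trans ?_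
  refine norm_expect_mul_mul_comp_add_le (c := fun y => g₄ (x + y)) (fun h => h₂ (x + h))
    (fun k => h₃ (x + k)) fun χ => ?_
  rw [norm_charCoeff_comp_add_left]
  exact hψ χ

end Fourier

section Derivative

variable {G : Type*} [AddCommGroup G]

/-- The multiplicative derivative `Δₕ f` of `f` in direction `h`. -/
noncomputable def mulDeriv (f : G → ℂ) (h x : G) : ℂ := f (x + h) * conj (f x)

lemma mulDeriv_mulDeriv (f : G → ℂ) (h k x : G) :
    mulDeriv (mulDeriv f h) k x = f x * conj (f (x + h)) * conj (f (x + k)) * f (x + h + k) := by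
  simp only [mulDeriv, map_mul, Complex.conj_conj, add_right_comm x k h]
  ring

lemma mulDeriv_comm (f : G → ℂ) (h k x : G) :
    mulDeriv (mulDeriv f h) k x = mulDeriv (mulDeriv f k) h x := by
  simp only [mulDeriv_mulDeriv, add_right_comm x h k]
  ring

lemma norm_mul_le_one {z w : ℂ} (hz : ‖z‖ ≤ 1) (hw : ‖w‖ ≤ 1) : ‖z * w‖ ≤ 1 := by
  rw [norm_mul]
  exact mul_le_one₀ hz (norm_nonneg w) hw

lemma norm_mulDeriv_le_one {f : G → ℂ} (hf : ∀ x, ‖f x‖ ≤ 1) (h x : G) : ‖mulDeriv f h x‖ ≤ 1 :=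
  norm_mul_le_one (hf _) (by rw [RCLike.norm_conj]; exact hf x)

variable [Fintype G]

lemma norm_sq_charCoeff (f : G → ℂ) (ψ : AddChar G ℂ) :
    ((‖charCoeff f ψ‖ ^ 2 : ℝ) : ℂ) = 𝔼 x, 𝔼 k, mulDeriv f k x * conj (ψ k) := by
  rw [Complex.ofReal_pow, ← Complex.conj_mul', charCoeff, map_expect, expect_mul_expect]
  refine expect_congr rfl fun x _ => ?_
  refine (Fintype.expect_equiv (Equiv.addLeft x) _ _ fun k => ?_).symm
  have hψ : ψ x * conj (ψ x) = 1 := by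
    rw [← AddChar.map_neg_eq_conj, ← AddChar.map_add_eq_mul, add_neg_cancel,
      AddChar.map_zero_eq_one]
  simp only [Equiv.coe_addLeft, mulDeriv, map_mul, Complex.conj_conj, AddChar.map_add_eq_mul]
  linear_combination (-(f (x + k) * conj (f x) * conj (ψ k))) * hψ

lemma norm_expect_mulDeriv_mul_le {g u : G → ℂ} (hg : ∀ x, ‖g x‖ ≤ 1) {η : ℝ}
    (hu : ∀ ψ, ‖charCoeff u ψ‖ ≤ η) : ‖𝔼 x, 𝔼 h, mulDeriv g h x * u h‖ ≤ η := by
  have hsub : 𝔼 x, 𝔼 h, mulDeriv g h x * u h = 𝔼 x, 𝔼 y, conj (g (-x)) * g y * u (x + y) := by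
    refine Fintype.expect_equiv (Equiv.neg G) _ _ fun x => ?_
    refine Fintype.expect_equiv (Equiv.addLeft x) _ _ fun h => ?_
    simp only [mulDeriv, Equiv.neg_apply, Equiv.coe_addLeft, neg_neg, neg_add_cancel_left]
    ring
  rw [hsub]
  exact norm_expect_mul_mul_comp_add_le (fun x => (RCLike.norm_conj _).trans_le (hg _)) hg hu

/-- The eighth power of the Gowers `U³`-norm of a complex-valued function. -/
noncomputable def complexCubeAverage (f : G → ℂ) : ℂ :=
  𝔼 h₁, 𝔼 h₂, 𝔼 h₃, 𝔼 x, mulDeriv (mulDeriv (mulDeriv f h₁) h₂) h₃ x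

lemma complexCubeAverage_ofReal (f : G → ℝ) :
    complexCubeAverage (fun x => (f x : ℂ)) = cubeAverage f := by
  simp only [complexCubeAverage, cubeAverage, Complex.ofReal_expect]
  refine expect_congr rfl fun h₁ _ => expect_congr rfl fun h₂ _ => expect_congr rfl fun h₃ _ =>
    expect_congr rfl fun x _ => ?_
  simp only [mulDeriv, map_mul, Complex.conj_ofReal, Complex.ofReal_mul, add_right_comm _ h₃,
    add_right_comm _ h₂ h₁]
  ring

lemma exists_norm_complexCubeAverage_sq_le {f : G → ℂ} (hf : ∀ x, ‖f x‖ ≤ 1) :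
    ∃ φ : G → AddChar G ℂ,
      ‖complexCubeAverage f‖ ^ 2 ≤ 𝔼 h, ‖charCoeff (mulDeriv f h) (φ h)‖ ^ 2 := by
  have hconj (h x : G) : ‖conj (mulDeriv f h x)‖ ≤ 1 := by
    rw [RCLike.norm_conj]
    exact norm_mulDeriv_le_one hf h x
  choose φ hφ using fun h => exists_norm_box_le_norm_charCoeff (mulDeriv f h)
    (norm_mulDeriv_le_one hf h) (hconj h) (hconj h)
  refine ⟨φ, (norm_expect_pow_le _ 2).trans (expect_le_expect fun h _ => ?_)⟩
  have hbox : 𝔼 k, 𝔼 l, 𝔼 x, mulDeriv (mulDeriv (mulDeriv f h) k) l x =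
      𝔼 x, 𝔼 k, 𝔼 l, mulDeriv f h x * conj (mulDeriv f h (x + k)) *
        conj (mulDeriv f h (x + l)) * mulDeriv f h (x + k + l) := by
    simp_rw [mulDeriv_mulDeriv (mulDeriv f h)]
    exact (expect_congr rfl fun k _ => expect_comm _ _ _).trans (expect_comm _ _ _)
  rw [hbox]
  gcongr
  exact hφ h

end Derivative

section Energy

lemma sum_norm_sum_addChar_pow_four {X Γ : Type*} [Fintype X] [AddCommGroup Γ] [Finite Γ]
    [DecidableEq Γ] (χ : X → AddChar Γ ℂ) {C : ℝ}
    (hχ : ∀ z, ∑ x, χ x z = if z = 0 then (C : ℂ) else 0) (A : Finset Γ) :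
    ∑ x, ‖∑ z ∈ A, χ x z‖ ^ 4 = C * E[A] := by
  have hexpand (x : X) : ((‖∑ z ∈ A, χ x z‖ ^ 4 : ℝ) : ℂ) =
      ∑ z ∈ (A ×ˢ A) ×ˢ (A ×ˢ A), χ x (z.1.1 + z.2.1 - (z.1.2 + z.2.2)) := by
    rw [Complex.ofReal_pow, show 4 = 2 * 2 from rfl, pow_mul, ← Complex.mul_conj', sq, map_sum,
      sum_mul_sum, ← sum_product', sum_mul_sum, ← sum_product']
    refine sum_congr rfl fun z _ => ?_
    rw [sub_eq_add_neg, neg_add]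
    simp only [AddChar.map_add_eq_mul, AddChar.map_neg_eq_conj]
    ring
  have hcomplex : ((∑ x, ‖∑ z ∈ A, χ x z‖ ^ 4 : ℝ) : ℂ) = (C * E[A] : ℝ) := by
    rw [Complex.ofReal_sum]
    simp_rw [hexpand]
    rw [sum_comm]
    simp_rw [hχ, sub_eq_zero]
    rw [addEnergy, sum_ite, sum_const_zero, add_zero, sum_const, nsmul_eq_mul, mul_comm]
    push_cast
    rfl
  exact_mod_cast hcomplex

variable {G : Type*} [AddCommGroup G]

/-- The character `(x, χ) ↦ ψ x * χ k` of `G × AddChar G ℂ` attached to the pair `(k, ψ)`, through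
which this group is its own dual. -/
def pairingChar (q : G × AddChar G ℂ) : AddChar (G × AddChar G ℂ) ℂ where
  toFun z := q.2 z.1 * z.2 q.1
  map_zero_eq_one' := by simp
  map_add_eq_mul' z w := by
    simp only [Prod.fst_add, Prod.snd_add, AddChar.map_add_eq_mul, AddChar.add_apply]
    ring

lemma pairingChar_apply (q z : G × AddChar G ℂ) : pairingChar q z = q.2 z.1 * z.2 q.1 := rfl

/-- The graph of `φ` over `H`. -/
def graphOver {H' : Type*} (φ : G → H') (H : Finset G) : Finset (G × H') :=
  H.map ⟨fun h => (h, φ h), fun _ _ h => congrArg Prod.fst h⟩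

variable [Fintype G]

lemma norm_expect_mulDeriv_mul_pow_four_le {g : G → ℂ} (hg : ∀ x, ‖g x‖ ≤ 1) (u : G → ℂ) :
    ‖𝔼 x, 𝔼 h, mulDeriv g h x * u h‖ ^ 4 ≤ ∑ ψ, ‖charCoeff u ψ‖ ^ 4 := by
  obtain ⟨ψ, hψ⟩ := Finite.exists_max fun ψ => ‖charCoeff u ψ‖
  calc ‖𝔼 x, 𝔼 h, mulDeriv g h x * u h‖ ^ 4 ≤ ‖charCoeff u ψ‖ ^ 4 := by
        gcongr
        exact norm_expect_mulDeriv_mul_le hg hψ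
    _ ≤ ∑ ψ, ‖charCoeff u ψ‖ ^ 4 :=
        single_le_sum (f := fun ψ => ‖charCoeff u ψ‖ ^ 4) (fun _ _ => by positivity) (mem_univ ψ)

variable [DecidableEq G]

lemma sum_pairingChar (z : G × AddChar G ℂ) :
    ∑ q, pairingChar q z = if z = 0 then (Fintype.card G : ℂ) ^ 2 else 0 := by
  simp_rw [Fintype.sum_prod_type, pairingChar_apply, ← sum_mul, ← mul_sum,
    AddChar.sum_apply_eq_ite, AddChar.sum_eq_ite]
  obtain ⟨x, χ⟩ := z
  by_cases hx : x = 0 <;> by_cases hχ : χ = 0 <;> simp [hx, hχ, sq]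

lemma norm_charCoeff_ite (φ : G → AddChar G ℂ) (H : Finset G) (k : G) (ψ : AddChar G ℂ) :
    ‖charCoeff (fun h => if h ∈ H then conj (φ h k) else 0) ψ‖ =
      ‖∑ z ∈ graphOver φ H, pairingChar (k, ψ) z‖ / Fintype.card G := by
  simp_rw [charCoeff, Fintype.expect_eq_sum_div_card, norm_div, Complex.norm_natCast, ite_mul,
    zero_mul, sum_ite_mem, univ_inter, ← map_mul, ← map_sum, RCLike.norm_conj, graphOver, sum_map,
    pairingChar_apply, mul_comm]
  rfl

lemma sum_norm_sq_charCoeff_mulDeriv (f : G → ℂ) (φ : G → AddChar G ℂ) (H : Finset G) :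
    ((∑ h ∈ H, ‖charCoeff (mulDeriv f h) (φ h)‖ ^ 2 : ℝ) : ℂ) = Fintype.card G *
      𝔼 k, 𝔼 x, 𝔼 h, mulDeriv (mulDeriv f k) h x * if h ∈ H then conj (φ h k) else 0 := by
  calc ((∑ h ∈ H, ‖charCoeff (mulDeriv f h) (φ h)‖ ^ 2 : ℝ) : ℂ)
      = ∑ h ∈ H, 𝔼 k, 𝔼 x, mulDeriv (mulDeriv f k) h x * conj (φ h k) := by
        rw [Complex.ofReal_sum]
        refine sum_congr rfl fun h _ => ?_
        rw [norm_sq_charCoeff, expect_comm]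
        simp_rw [mulDeriv_comm f h]
    _ = 𝔼 k, 𝔼 x, ∑ h ∈ H, mulDeriv (mulDeriv f k) h x * conj (φ h k) := by
        simp_rw [expect_sum_comm]
    _ = _ := by
        have hsum (g : G → ℂ) : ∑ h ∈ H, g h = Fintype.card G * 𝔼 h, if h ∈ H then g h else 0 := by
          rw [Fintype.card_mul_expect, sum_ite_mem, univ_inter]
        simp_rw [hsum, ← mul_expect, mul_ite, mul_zero]

lemma expect_sum_norm_charCoeff_ite_pow_four (φ : G → AddChar G ℂ) (H : Finset G) :
    𝔼 k, ∑ ψ, ‖charCoeff (fun h => if h ∈ H then conj (φ h k) else 0) ψ‖ ^ 4 =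
      E[graphOver φ H] / (Fintype.card G : ℝ) ^ 3 := by
  have henergy := sum_norm_sum_addChar_pow_four (X := G × AddChar G ℂ) (Γ := G × AddChar G ℂ)
    (C := (Fintype.card G : ℝ) ^ 2) pairingChar
    (fun z => by rw [sum_pairingChar, Complex.ofReal_pow, Complex.ofReal_natCast]) (graphOver φ H)
  rw [Fintype.sum_prod_type] at henergy
  simp_rw [norm_charCoeff_ite, div_pow, ← sum_div, Fintype.expect_eq_sum_div_card, ← sum_div,
    henergy]
  field_simp

lemma le_addEnergy_graphOver {f : G → ℂ} (hf : ∀ x, ‖f x‖ ≤ 1) (φ : G → AddChar G ℂ)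
    (H : Finset G) {c : ℝ} (hc : 0 ≤ c)
    (hH : c * Fintype.card G ≤ ∑ h ∈ H, ‖charCoeff (mulDeriv f h) (φ h)‖ ^ 2) :
    c ^ 4 * Fintype.card G ^ 3 ≤ E[graphOver φ H] := by
  have hcT : c ≤ ‖𝔼 k, 𝔼 x, 𝔼 h, mulDeriv (mulDeriv f k) h x *
      if h ∈ H then conj (φ h k) else 0‖ := by
    have hsum := congrArg norm (sum_norm_sq_charCoeff_mulDeriv f φ H)
    rw [Complex.norm_of_nonneg (by positivity), norm_mul, Complex.norm_natCast] at hsum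
    rw [hsum, mul_comm] at hH
    exact le_of_mul_le_mul_left hH (Nat.cast_pos.2 Fintype.card_pos)
  have hN : 0 < (Fintype.card G : ℝ) ^ 3 := pow_pos (Nat.cast_pos.2 Fintype.card_pos) 3
  rw [← le_div_iff₀ hN, ← expect_sum_norm_charCoeff_ite_pow_four]
  refine (pow_le_pow_left₀ hc hcT 4).trans ((norm_expect_pow_le _ 4).trans ?_)
  exact expect_le_expect fun k _ =>
    norm_expect_mulDeriv_mul_pow_four_le (norm_mulDeriv_le_one hf k) _

end Energy

section BalogSzemerediGowers

lemma exists_subset_card_filter_le {α : Type*} (D : Finset α) (R : α → α → Prop)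
    [∀ p q, Decidable (R p q)]
    (hR : 16 * (#{z ∈ D ×ˢ D | R z.1 z.2} : ℝ) ≤ #D ^ 2) :
    ∃ B ⊆ D, (#D : ℝ) / 2 ≤ #B ∧ ∀ p ∈ B, (#{q ∈ D | R p q} : ℝ) ≤ #D / 4 := by
  obtain rfl | hD := D.eq_empty_or_nonempty
  · exact ⟨∅, by simp⟩
  have hD0 : (0 : ℝ) < #D := Nat.cast_pos.2 hD.card_pos
  let few (p : α) : Prop := (#{q ∈ D | R p q} : ℝ) ≤ #D / 4
  refine ⟨{p ∈ D | few p}, filter_subset _ _, ?_, fun p hp => (mem_filter.1 hp).2⟩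
  have hpairs : ∑ p ∈ D, (#{q ∈ D | R p q} : ℝ) = #{z ∈ D ×ˢ D | R z.1 z.2} := by
    simp_rw [card_filter]
    rw [sum_product]
    push_cast
    rfl
  have hmany : (#{p ∈ D | ¬ few p} : ℝ) * (#D / 4) ≤ #{z ∈ D ×ˢ D | R z.1 z.2} := by
    rw [← hpairs, ← nsmul_eq_mul]
    refine (card_nsmul_le_sum _ _ _ fun p hp => (not_le.1 (mem_filter.1 hp).2).le).trans ?_
    exact sum_le_sum_of_subset_of_nonneg (filter_subset _ _) fun _ _ _ => Nat.cast_nonneg _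
  have hsplit : (#{p ∈ D | few p} : ℝ) + #{p ∈ D | ¬ few p} = #D :=
    mod_cast card_filter_add_card_filter_not (s := D) few
  nlinarith

variable {G : Type*} [AddCommGroup G] [DecidableEq G]

lemma card_vadd_neg_inter_vadd_neg (A : Finset G) (p q : G) :
    #((p +ᵥ -A) ∩ (q +ᵥ -A)) = A.addConvolution (-A) (p - q) := by
  rw [← card_inter_vadd]
  refine card_equiv (Equiv.subLeft p) fun x => ?_
  simp only [mem_inter, ← neg_vadd_mem_iff, vadd_eq_add, mem_neg', Equiv.subLeft_apply]
  rw [neg_add_rev, neg_add_rev, neg_neg, neg_neg, neg_add_eq_sub, neg_add_eq_sub,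
    neg_add_eq_sub, sub_sub_sub_cancel_left]

lemma sum_addConvolution_neg_le (A s : Finset G) :
    ∑ x ∈ s, (A.addConvolution (-A) x : ℝ) ≤ #A ^ 2 := by
  have h : ∑ x ∈ s, A.addConvolution (-A) x ≤ #(A ×ˢ (-A)) :=
    (sum_card_fiberwise_eq_card_filter _ _ _).trans_le (card_filter_le _ _)
  rw [card_product, card_neg, ← sq] at h
  exact_mod_cast h

lemma addEnergy_self_eq_sum_sq (A : Finset G) :
    E[A] = ∑ d ∈ A - A, A.addConvolution (-A) d ^ 2 := by
  rw [addEnergy, card_eq_sum_card_fiberwise (f := fun z => z.1.1 - z.1.2) (t := A - A)]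
  · refine sum_congr rfl fun d _ => ?_
    rw [sq, ← card_sub_eq, ← card_product]
    refine card_equiv ((Equiv.refl _).prodCongr (.prodComm _ _)) fun z => ?_
    have hz : z.1.1 + z.2.1 = z.1.2 + z.2.2 ↔ z.1.1 - z.1.2 = z.2.2 - z.2.1 := by
      rw [sub_eq_sub_iff_add_eq_add, add_comm z.1.2]
    simp only [mem_filter, mem_product, Equiv.prodCongr_apply, Equiv.coe_refl, Equiv.prodComm_apply,
      Prod.map_fst, Prod.map_snd, id, Prod.fst_swap, Prod.snd_swap, hz]
    grind
  · intro z hz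
    simp only [coe_filter, mem_product, Set.mem_ofPred_eq] at hz
    exact sub_mem_sub hz.1.1.1 hz.1.1.2

lemma sum_card_unpopular_le (A s : Finset G) {t : ℝ} (ht : 0 ≤ t) :
    ∑ x ∈ s, (#{z ∈ (A ∩ (x +ᵥ A)) ×ˢ (A ∩ (x +ᵥ A)) |
      (A.addConvolution (-A) (z.1 - z.2) : ℝ) < t} : ℝ) ≤ t * #A ^ 2 := by
  let P : Finset (G × G) := {z ∈ A ×ˢ A | (A.addConvolution (-A) (z.1 - z.2) : ℝ) < t}
  have hfibre (x : G) : (#{z ∈ (A ∩ (x +ᵥ A)) ×ˢ (A ∩ (x +ᵥ A)) |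
      (A.addConvolution (-A) (z.1 - z.2) : ℝ) < t} : ℝ) =
      ∑ z ∈ P, if x ∈ (z.1 +ᵥ -A) ∩ (z.2 +ᵥ -A) then (1 : ℝ) else 0 := by
    rw [sum_boole, filter_filter]
    congr 2
    ext z
    simp only [mem_filter, mem_product, mem_inter, ← neg_vadd_mem_iff, vadd_eq_add, mem_neg',
      neg_add_rev, neg_neg, add_comm (-x)]
    tauto
  simp_rw [hfibre]
  rw [sum_comm]
  calc ∑ z ∈ P, ∑ x ∈ s, (if x ∈ (z.1 +ᵥ -A) ∩ (z.2 +ᵥ -A) then (1 : ℝ) else 0)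
      ≤ ∑ _z ∈ P, t := by
        refine sum_le_sum fun z hz => ?_
        rw [sum_boole, filter_mem_eq_inter]
        refine le_trans ?_ (mem_filter.1 hz).2.le
        rw [← card_vadd_neg_inter_vadd_neg]
        exact mod_cast card_le_card inter_subset_right
    _ ≤ ∑ _z ∈ A ×ˢ A, t := sum_le_sum_of_subset_of_nonneg (filter_subset _ _) fun _ _ _ => ht
    _ = t * #A ^ 2 := by
        rw [sum_const, card_product, nsmul_eq_mul, Nat.cast_mul]
        ring

lemma exists_vadd_inter_popular {A : Finset G} (hA : A.Nonempty) {c : ℝ} (hc : 0 < c)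
    (hE : c * #A ^ 3 ≤ E[A]) :
    ∃ D ⊆ A, c / 4 * #A < #D ∧
      16 * (#{z ∈ D ×ˢ D | (A.addConvolution (-A) (z.1 - z.2) : ℝ) < c / 32 * #A} : ℝ) ≤
        #D ^ 2 := by
  let r (x : G) : ℝ := A.addConvolution (-A) x
  let bad (x : G) : ℝ := #{z ∈ (A ∩ (x +ᵥ A)) ×ˢ (A ∩ (x +ᵥ A)) |
    (A.addConvolution (-A) (z.1 - z.2) : ℝ) < c / 32 * #A}
  have hbad : ∑ x ∈ A - A, bad x ≤ c / 32 * #A * #A ^ 2 :=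
    sum_card_unpopular_le A _ (by positivity)
  have hr : ∑ x ∈ A - A, r x ≤ #A ^ 2 := sum_addConvolution_neg_le A _
  have hr2 : c * #A ^ 3 ≤ ∑ x ∈ A - A, r x ^ 2 := hE.trans_eq (by
    rw [addEnergy_self_eq_sum_sq, Nat.cast_sum]
    exact sum_congr rfl fun x _ => Nat.cast_pow _ _)
  have hpos : 0 < ∑ x ∈ A - A, (r x ^ 2 - 16 * bad x - c / 4 * #A * r x) := by
    rw [sum_sub_distrib, sum_sub_distrib, ← mul_sum, ← mul_sum]
    have hr' := mul_le_mul_of_nonneg_left hr (by positivity : 0 ≤ c / 4 * #A)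
    have : 0 < c * #A ^ 3 := by positivity
    linarith
  obtain ⟨x, -, hx⟩ := exists_lt_of_sum_lt (sum_const_zero.trans_lt hpos)
  have hbad0 : 0 ≤ bad x := Nat.cast_nonneg _
  have hr0 : 0 ≤ r x := Nat.cast_nonneg _
  have hcard : (#(A ∩ (x +ᵥ A)) : ℝ) = r x := by rw [card_inter_vadd]
  refine ⟨A ∩ (x +ᵥ A), inter_subset_left, ?_, ?_⟩
  · rw [hcard]
    by_contra! h
    nlinarith [mul_le_mul_of_nonneg_right h hr0]
  · change 16 * bad x ≤ _
    rw [hcard]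
    have : 0 ≤ c / 4 * #A * r x := by positivity
    linarith

/-- If `p - q` and `p' - q` are both popular, then `p - p' = (p - q) - (p' - q)` has many
representations. -/
lemma le_sum_addConvolution_mul_addConvolution {A D : Finset G} (hD : D ⊆ A) {t : ℝ} (ht : 0 ≤ t)
    {p p' : G} (hpA : p ∈ A)
    (hp : (#{q ∈ D | (A.addConvolution (-A) (p - q) : ℝ) < t} : ℝ) ≤ #D / 4)
    (hp' : (#{q ∈ D | (A.addConvolution (-A) (p' - q) : ℝ) < t} : ℝ) ≤ #D / 4) :
    #D / 2 * t ^ 2 ≤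
      ∑ e ∈ A - A, (A.addConvolution (-A) e : ℝ) * A.addConvolution (-A) (e - (p - p')) := by
  let r (x : G) : ℝ := A.addConvolution (-A) x
  let Q : Finset G := D \ ({q ∈ D | r (p - q) < t} ∪ {q ∈ D | r (p' - q) < t})
  have hQ : (#D : ℝ) / 2 ≤ #Q := by
    have hcard : #D ≤ #Q + (#{q ∈ D | r (p - q) < t} + #{q ∈ D | r (p' - q) < t}) :=
      card_le_card_sdiff_add_card.trans (by gcongr; exact card_union_le _ _)
    have : (#D : ℝ) ≤ #Q + (#{q ∈ D | r (p - q) < t} + #{q ∈ D | r (p' - q) < t}) := by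
      exact_mod_cast hcard
    linarith
  calc #D / 2 * t ^ 2 ≤ #Q * t ^ 2 := by gcongr
    _ ≤ ∑ q ∈ Q, r (p - q) * r (p' - q) := by
        rw [← nsmul_eq_mul]
        refine card_nsmul_le_sum _ _ _ fun q hq => ?_
        simp only [Q, mem_sdiff, mem_union, mem_filter, not_or, not_and, not_lt] at hq
        rw [sq]
        exact mul_le_mul (hq.2.1 hq.1) (hq.2.2 hq.1) ht (Nat.cast_nonneg _)
    _ = ∑ e ∈ Q.image (p - ·), r e * r (e - (p - p')) := by
        rw [sum_image sub_right_injective.injOn]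
        exact sum_congr rfl fun q _ => by rw [sub_sub_sub_cancel_left]
    _ ≤ ∑ e ∈ A - A, r e * r (e - (p - p')) :=
        sum_le_sum_of_subset_of_nonneg
          (image_subset_iff.2 fun q hq => sub_mem_sub hpA (hD (sdiff_subset hq)))
          fun _ _ _ => by positivity

/-- The **Balog–Szemerédi–Gowers theorem**, for difference sets. -/
theorem exists_card_sub_le_of_le_addEnergy {A : Finset G} (hA : A.Nonempty) {c : ℝ} (hc : 0 < c)
    (hE : c * #A ^ 3 ≤ E[A]) :
    ∃ B ⊆ A, c / 8 * #A ≤ #B ∧ (#(B - B) : ℝ) ≤ 8192 / c ^ 3 * #A := by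
  obtain ⟨D, hDA, hD, hpairs⟩ := exists_vadd_inter_popular hA hc hE
  obtain ⟨B, hBD, hB, hfew⟩ := exists_subset_card_filter_le D
    (fun p q => (A.addConvolution (-A) (p - q) : ℝ) < c / 32 * #A) hpairs
  refine ⟨B, hBD.trans hDA, by linarith, ?_⟩
  let r (x : G) : ℝ := A.addConvolution (-A) x
  have hr (s : Finset G) : ∑ x ∈ s, r x ≤ #A ^ 2 := sum_addConvolution_neg_le A s
  have htotal : ∑ d ∈ B - B, ∑ e ∈ A - A, r e * r (e - d) ≤ #A ^ 4 := by
    rw [sum_comm]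
    calc ∑ e ∈ A - A, ∑ d ∈ B - B, r e * r (e - d) ≤ ∑ e ∈ A - A, r e * #A ^ 2 := by
          refine sum_le_sum fun e _ => ?_
          rw [← mul_sum, ← sum_image (g := (e - ·)) (f := r) sub_right_injective.injOn]
          exact mul_le_mul_of_nonneg_left (hr _) (Nat.cast_nonneg _)
      _ ≤ #A ^ 2 * #A ^ 2 := by
          rw [← sum_mul]
          gcongr
          exact hr _
      _ = #A ^ 4 := by ring
  have hdiff : ∀ d ∈ B - B, #D / 2 * (c / 32 * #A) ^ 2 ≤ ∑ e ∈ A - A, r e * r (e - d) := by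
    intro d hd
    obtain ⟨p, hp, p', hp', rfl⟩ := mem_sub.1 hd
    exact le_sum_addConvolution_mul_addConvolution hDA (by positivity) (hDA (hBD hp)) (hfew p hp)
      (hfew p' hp')
  have hmain : #(B - B) * (c / 4 * #A / 2 * (c / 32 * #A) ^ 2) ≤ (#A : ℝ) ^ 4 := by
    refine le_trans ?_ htotal
    rw [← nsmul_eq_mul]
    refine card_nsmul_le_sum _ _ _ fun d hd => le_trans ?_ (hdiff d hd)
    gcongr
  refine le_of_mul_le_mul_right (hmain.trans_eq ?_)
    (by positivity : 0 < c / 4 * #A / 2 * (c / 32 * #A) ^ 2)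
  field_simp
  norm_num

end BalogSzemerediGowers

section FreimanRuzsa

lemma span_zmod_subset {n : ℕ} [NeZero n] {V : Type*} [AddCommGroup V] [Module (ZMod n) V]
    {B T : Set V} (hzero : 0 ∈ T) (hadd : ∀ b ∈ B, ∀ t ∈ T, b + t ∈ T) :
    (Submodule.span (ZMod n) B : Set V) ⊆ T := by
  suffices h : ∀ x ∈ Submodule.span (ZMod n) B, ∀ t ∈ T, x + t ∈ T by
    intro x hx
    simpa only [add_zero] using h x hx 0 hzero
  intro x hx
  induction hx using Submodule.span_induction with
  | mem x hx => exact hadd x hx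
  | zero => simp only [zero_add, imp_self, implies_true]
  | add x y _ _ hx hy =>
    intro t ht
    rw [add_assoc]
    exact hx _ (hy t ht)
  | smul c x _ hx =>
    have hnsmul (m : ℕ) : ∀ t ∈ T, m • x + t ∈ T := by
      induction m with
      | zero => simp only [zero_nsmul, zero_add, imp_self, implies_true]
      | succ m ih =>
        intro t ht
        rw [succ_nsmul, add_assoc]
        exact ih _ (hx t ht)
    rw [← ZMod.natCast_zmod_val c, Nat.cast_smul_eq_nsmul]
    exact hnsmul _

lemma card_add_sub_add_le {G : Type*} [AddCommGroup G] [DecidableEq G] {B : Finset G}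
    (hB : B.Nonempty) {K : ℝ} (hK : (#(B - B) : ℝ) ≤ K * #B) :
    (#(B + (B - B) + B) : ℝ) ≤ K ^ 4 * #B := by
  have hpluennecke := (NNRat.cast_le (K := ℝ)).2
    (pluennecke_ruzsa_inequality_nsmul_sub_nsmul_sub hB B 3 1)
  push_cast at hpluennecke
  have hsum : B + (B - B) + B = 3 • B - 1 • B := by
    rw [one_nsmul, succ_nsmul, two_nsmul, sub_eq_add_neg, sub_eq_add_neg, ← add_assoc,
      add_right_comm]
  rw [hsum]
  refine hpluennecke.trans ?_
  gcongr
  rwa [div_le_iff₀ (Nat.cast_pos.2 hB.card_pos)]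

variable {p : ℕ} [Fact p.Prime] {V : Type*} [AddCommGroup V] [Module (ZMod p) V]

lemma natCard_span_finset_le (F : Finset V) :
    Nat.card (Submodule.span (ZMod p) (F : Set V)) ≤ p ^ #F := by
  rw [Module.natCard_eq_pow_finrank (K := ZMod p), Nat.card_zmod]
  exact Nat.pow_le_pow_right (Fact.out : p.Prime).pos (finrank_span_finset_le_card F)

/-- **Freiman's theorem** for vector spaces over `𝔽ₚ`. -/
theorem natCard_span_le_of_card_sub_le [DecidableEq V] {B : Finset V} (hB : B.Nonempty) {K : ℝ}
    (hK : (#(B - B) : ℝ) ≤ K * #B) :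
    (Nat.card (Submodule.span (ZMod p) (B : Set V)) : ℝ) ≤ p ^ (K ^ 4) * (K * #B) := by
  obtain ⟨F, -, hFK, hF⟩ := ruzsa_covering_add hB (card_add_sub_add_le hB hK)
  let S := Submodule.span (ZMod p) (F : Set V)
  have : Finite S := Module.finite_of_finite (ZMod p)
  have hspan : (Submodule.span (ZMod p) (B : Set V) : Set V) ⊆
      (S : Set V) + ((B - B : Finset V) : Set V) := by
    refine span_zmod_subset ?_ ?_
    · exact ⟨0, S.zero_mem, 0, mem_coe.2 hB.zero_mem_sub, add_zero 0⟩
    · rintro b hb _ ⟨s, hs, d, hd, rfl⟩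
      obtain ⟨f, hf, d', hd', h⟩ := mem_add.1 (hF (add_mem_add hb hd))
      refine ⟨f + s, S.add_mem (Submodule.subset_span hf) hs, d', hd', ?_⟩
      simp only at h ⊢
      rw [add_right_comm, h]
      abel
  have hS : (Nat.card S : ℝ) ≤ p ^ (K ^ 4) :=
    calc (Nat.card S : ℝ) ≤ (p : ℝ) ^ (#F : ℝ) := by
          rw [Real.rpow_natCast]
          exact_mod_cast natCard_span_finset_le F
      _ ≤ p ^ (K ^ 4) :=
          Real.rpow_le_rpow_of_exponent_le (mod_cast (Fact.out : p.Prime).one_le) hFK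
  have hcard : Nat.card (Submodule.span (ZMod p) (B : Set V)) ≤ Nat.card S * #(B - B) := by
    calc _ ≤ Nat.card ((S : Set V) + ((B - B : Finset V) : Set V) : Set V) :=
          Nat.card_mono ((S : Set V).toFinite.add (finite_toSet _)) hspan
      _ ≤ Nat.card (S : Set V) * Nat.card ((B - B : Finset V) : Set V) := Set.natCard_add_le
      _ = Nat.card S * #(B - B) := by
        rw [Nat.card_coe_set_eq ((B - B : Finset V) : Set V), Set.ncard_coe_finset]
        rfl
  calc (Nat.card (Submodule.span (ZMod p) (B : Set V)) : ℝ)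
      ≤ Nat.card S * #(B - B) := by exact_mod_cast hcard
    _ ≤ p ^ (K ^ 4) * (K * #B) := by gcongr

end FreimanRuzsa

section Linearization

universe u v

variable {K V W : Type*} [Field K] [AddCommGroup V] [Module K V] [AddCommGroup W] [Module K W]

lemma exists_linearMap_forall_mem_sub_mem (S : Submodule K (V × W)) :
    ∃ L : V →ₗ[K] W, ∀ z ∈ S, (0, z.2 - L z.1) ∈ S := by
  let π : S →ₗ[K] V := (LinearMap.fst K V W).domRestrict S
  obtain ⟨σ, hσ⟩ := π.rangeRestrict.exists_rightInverse_of_surjective π.range_rangeRestrict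
  obtain ⟨L, hL⟩ := LinearMap.exists_extend (((LinearMap.snd K V W).domRestrict S).comp σ)
  refine ⟨L, fun z hz => ?_⟩
  let lift : S := σ (π.rangeRestrict ⟨z, hz⟩)
  have hfst : lift.1.1 = z.1 :=
    congrArg Subtype.val (LinearMap.congr_fun hσ (π.rangeRestrict ⟨z, hz⟩))
  have hsnd : lift.1.2 = L z.1 := (LinearMap.congr_fun hL (π.rangeRestrict ⟨z, hz⟩)).symm
  have hfibre : z - lift.1 = (0, z.2 - L z.1) :=
    Prod.ext (by rw [Prod.fst_sub, hfst, sub_self]) (by rw [Prod.snd_sub, hsnd])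
  exact hfibre ▸ S.sub_mem hz lift.2

lemma card_mul_card_fibre_le {B : Finset (V × W)} {U : Finset W} {S : Submodule K (V × W)}
    [Finite S] (hB : Set.InjOn Prod.fst (B : Set (V × W))) (hBS : ∀ z ∈ B, z ∈ S)
    (hU : ∀ w ∈ U, (0, w) ∈ S) : #B * #U ≤ Nat.card S := by
  have hmem : ∀ z ∈ ((B ×ˢ U : Finset ((V × W) × W)) : Set ((V × W) × W)),
      z.1 + (0, z.2) ∈ (S : Set (V × W)) := fun z hz =>
    S.add_mem (hBS _ (mem_product.1 hz).1) (hU _ (mem_product.1 hz).2)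
  rw [← card_product, ← Set.ncard_coe_finset]
  refine Set.ncard_le_ncard_of_injOn _ hmem ?_ (S : Set (V × W)).toFinite
  intro z hz w hw h
  have hsum : z.1 + (0, z.2) = w.1 + (0, w.2) := h
  have hzw : z.1 = w.1 := hB (mem_product.1 hz).1 (mem_product.1 hw).1
    (by simpa only [Prod.fst_add, add_zero] using congrArg Prod.fst hsum)
  rw [hzw] at hsum
  exact Prod.ext hzw (Prod.mk_right_injective 0 (add_left_cancel hsum))

/-- A subspace `S` containing much of the graph of `φ` is covered by few translates of the graph of
a linear map `L`, and `φ - L` is constant on the points of the most popular one. -/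
lemma exists_linearMap_card_sq_le [DecidableEq W] {φ : V → W} {H : Finset V}
    {B : Finset (V × W)} (hB : B ⊆ graphOver φ H) (S : Submodule K (V × W)) [Finite S]
    (hBS : ∀ z ∈ B, z ∈ S) :
    ∃ (L : V →ₗ[K] W) (b : W), #B ^ 2 ≤ Nat.card S * #{h ∈ H | φ h = L h + b} := by
  obtain ⟨L, hL⟩ := exists_linearMap_forall_mem_sub_mem S
  obtain rfl | hBne := B.eq_empty_or_nonempty
  · exact ⟨L, 0, by simp⟩
  let κ (z : V × W) : W := z.2 - L z.1
  have hgraph : ∀ z ∈ B, z.1 ∈ H ∧ φ z.1 = z.2 := by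
    intro z hz
    obtain ⟨h, hh, rfl⟩ := mem_map.1 (hB hz)
    exact ⟨hh, rfl⟩
  have hinj : Set.InjOn Prod.fst (B : Set (V × W)) := fun z hz w hw h =>
    Prod.ext h (by rw [← (hgraph z hz).2, ← (hgraph w hw).2, h])
  obtain ⟨b, -, hb⟩ := exists_max_image (B.image κ) (fun b => #{z ∈ B | κ z = b}) (hBne.image κ)
  have hfibre : #{z ∈ B | κ z = b} ≤ #{h ∈ H | φ h = L h + b} := by
    refine card_le_card_of_injOn Prod.fst ?_ (hinj.mono fun z hz => (mem_filter.1 hz).1)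
    intro z hz
    obtain ⟨hzB, rfl⟩ := mem_filter.1 hz
    refine mem_filter.2 ⟨(hgraph z hzB).1, ?_⟩
    rw [(hgraph z hzB).2, add_sub_cancel]
  have himage : #B * #(B.image κ) ≤ Nat.card S :=
    card_mul_card_fibre_le hinj hBS (forall_mem_image.2 fun z hz => hL z (hBS z hz))
  refine ⟨L, b, ?_⟩
  calc #B ^ 2 ≤ #B * (#{z ∈ B | κ z = b} * #(B.image κ)) := by
        rw [sq]
        exact Nat.mul_le_mul_left _ (card_le_mul_card_image _ _ hb)
    _ = #B * #(B.image κ) * #{z ∈ B | κ z = b} := by ring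
    _ ≤ Nat.card S * #{h ∈ H | φ h = L h + b} := Nat.mul_le_mul himage hfibre

lemma exists_linearMap_of_le_addEnergy_graphOver (p : ℕ) [Fact p.Prime] {c : ℝ} (hc : 0 < c) :
    ∃ c' : ℝ, 0 < c' ∧ ∀ {V : Type u} {W : Type v} [AddCommGroup V] [AddCommGroup W]
      [Module (ZMod p) V] [Module (ZMod p) W] [DecidableEq V] [DecidableEq W]
      (φ : V → W) (H : Finset V), c * #H ^ 3 ≤ E[graphOver φ H] →
      ∃ (L : V →ₗ[ZMod p] W) (b : W), c' * #H ≤ #{h ∈ H | φ h = L h + b} := by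
  set K : ℝ := 8192 / c ^ 3 * (8 / c) with hK
  have hp : 0 < (p : ℝ) := Nat.cast_pos.2 (Fact.out : p.Prime).pos
  refine ⟨c / 8 / (p ^ (K ^ 4) * K), by positivity, ?_⟩
  intro V W _ _ _ _ _ _ φ H hE
  obtain rfl | hH := H.eq_empty_or_nonempty
  · exact ⟨0, 0, by simp⟩
  have hcard : #(graphOver φ H) = #H := card_map _
  have hgraph : (graphOver φ H).Nonempty := hH.map
  obtain ⟨B, hBA, hB, hBB⟩ := exists_card_sub_le_of_le_addEnergy hgraph hc (by rwa [hcard])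
  rw [hcard] at hB hBB
  have hB0 : (0 : ℝ) < #B := (by positivity : 0 < c / 8 * (#H : ℝ)).trans_le hB
  have hdoubling : (#(B - B) : ℝ) ≤ K * #B := by
    refine hBB.trans ?_
    rw [hK, mul_assoc]
    gcongr
    rw [div_mul_eq_mul_div, le_div_iff₀ hc]
    linarith
  let S := Submodule.span (ZMod p) (B : Set (V × W))
  have hS : (Nat.card S : ℝ) ≤ p ^ (K ^ 4) * (K * #B) :=
    natCard_span_le_of_card_sub_le (card_pos.1 (Nat.cast_pos.1 hB0)) hdoubling
  have : Finite S := Module.finite_of_finite (ZMod p)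
  obtain ⟨L, b, hLb⟩ := exists_linearMap_card_sq_le hBA S fun z hz => Submodule.subset_span hz
  refine ⟨L, b, ?_⟩
  have hBL : (#B : ℝ) ≤ #{h ∈ H | φ h = L h + b} * (p ^ (K ^ 4) * K) := by
    refine le_of_mul_le_mul_right ?_ hB0
    calc (#B : ℝ) * #B = (#B : ℝ) ^ 2 := (sq _).symm
      _ ≤ Nat.card S * #{h ∈ H | φ h = L h + b} := by exact_mod_cast hLb
      _ ≤ p ^ (K ^ 4) * (K * #B) * #{h ∈ H | φ h = L h + b} := by gcongr
      _ = #{h ∈ H | φ h = L h + b} * (p ^ (K ^ 4) * K) * #B := by ring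
  rw [div_mul_eq_mul_div, div_le_iff₀ (by positivity)]
  exact hB.trans hBL

end Linearization

section AffineDerivative

universe u

lemma mul_card_le_sum_filter_le {α : Type*} [Fintype α] {s : α → ℝ} {c : ℝ} (hc : 0 ≤ c)
    (hs : 2 * c ≤ 𝔼 x, s x) : c * Fintype.card α ≤ ∑ x with c ≤ s x, s x := by
  have hrest : ∑ x with ¬c ≤ s x, s x ≤ c * Fintype.card α := by
    calc ∑ x with ¬c ≤ s x, s x ≤ #{x | ¬c ≤ s x} • c :=
          sum_le_card_nsmul _ _ _ fun x hx => (not_le.1 (mem_filter.1 hx).2).le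
      _ ≤ c * Fintype.card α := by
          rw [nsmul_eq_mul, mul_comm]
          gcongr
          exact card_le_univ _
  have hall : 2 * c * Fintype.card α ≤ ∑ x, s x := by
    rw [← Fintype.card_mul_expect, mul_comm]
    gcongr
  rw [← sum_filter_add_sum_filter_not univ (fun x => c ≤ s x)] at hall
  linarith

lemma exists_addMonoidHom_le_expect_norm_sq_charCoeff_mulDeriv (p : ℕ) [Fact p.Prime] {c₀ : ℝ}
    (hc₀ : 0 < c₀) :
    ∃ c : ℝ, 0 < c ∧ ∀ {V : Type u} [AddCommGroup V] [Module (ZMod p) V] [Fintype V] {f : V → ℂ},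
      (∀ x, ‖f x‖ ≤ 1) → ∀ φ : V → AddChar V ℂ,
        2 * c₀ ≤ 𝔼 h, ‖charCoeff (mulDeriv f h) (φ h)‖ ^ 2 →
        ∃ (M : V →+ AddChar V ℂ) (b : AddChar V ℂ),
          c ≤ 𝔼 h, ‖charCoeff (mulDeriv f h) (M h + b)‖ ^ 2 := by
  classical
  obtain ⟨c, hc, hlinear⟩ :=
    exists_linearMap_of_le_addEnergy_graphOver.{u, u} p (c := c₀ ^ 4) (by positivity)
  refine ⟨c * c₀ ^ 2, by positivity, fun {V} _ _ _ {f} hf φ hφ => ?_⟩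
  let : Module (ZMod p) (AddChar V ℂ) := AddCommGroup.zmodModule fun ψ => by
    ext x
    rw [AddChar.nsmul_apply, ← AddChar.map_nsmul_eq_pow, ZModModule.char_nsmul_eq_zero,
      AddChar.map_zero_eq_one, AddChar.zero_apply]
  let s (h : V) : ℝ := ‖charCoeff (mulDeriv f h) (φ h)‖ ^ 2
  let H : Finset V := {h | c₀ ≤ s h}
  have hsum : c₀ * Fintype.card V ≤ ∑ h ∈ H, s h := mul_card_le_sum_filter_le hc₀.le hφ
  have hcard : c₀ * Fintype.card V ≤ #H := by
    refine hsum.trans ((sum_le_card_nsmul _ _ 1 fun h _ => ?_).trans_eq (nsmul_one _))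
    exact pow_le_one₀ (norm_nonneg _) (norm_charCoeff_le_one (norm_mulDeriv_le_one hf h) _)
  have henergy : c₀ ^ 4 * (#H : ℝ) ^ 3 ≤ E[graphOver φ H] := by
    refine le_trans ?_ (le_addEnergy_graphOver hf φ H hc₀.le hsum)
    gcongr
    exact card_le_univ H
  obtain ⟨L, b, hL⟩ := hlinear φ H henergy
  let M : V →+ AddChar V ℂ := L.toAddMonoidHom
  have hM : c * #H ≤ #{h ∈ H | φ h = M h + b} := hL
  refine ⟨M, b, ?_⟩
  rw [Fintype.expect_eq_sum_div_card, le_div_iff₀ (Nat.cast_pos.2 Fintype.card_pos)]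
  calc c * c₀ ^ 2 * Fintype.card V = c * (c₀ * Fintype.card V) * c₀ := by ring
    _ ≤ c * #H * c₀ := by gcongr
    _ ≤ #{h ∈ H | φ h = M h + b} * c₀ := by gcongr
    _ = #{h ∈ H | φ h = M h + b} • c₀ := (nsmul_eq_mul _ _).symm
    _ ≤ ∑ h ∈ H with φ h = M h + b, ‖charCoeff (mulDeriv f h) (M h + b)‖ ^ 2 := by
        refine card_nsmul_le_sum _ _ _ fun h hh => ?_
        obtain ⟨hhH, hφh⟩ := mem_filter.1 hh
        exact hφh ▸ (mem_filter.1 hhH).2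
    _ ≤ ∑ h, ‖charCoeff (mulDeriv f h) (M h + b)‖ ^ 2 :=
        sum_le_sum_of_subset_of_nonneg (subset_univ _) fun _ _ _ => by positivity

end AffineDerivative

section Symmetry

variable {G : Type*} [AddCommGroup G]

/-- The transpose `(y, x) ↦ M x y` of a bicharacter `M`. -/
def flipBichar {H : Type*} [AddCommGroup H] (M : G →+ AddChar H ℂ) : H →+ AddChar G ℂ where
  toFun y := (AddChar.doubleDualEmb y).compAddMonoidHom M
  map_zero' := by
    ext x
    exact (M x).map_zero_eq_one
  map_add' y z := by
    ext x
    exact (M x).map_add_eq_mul y z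

lemma flipBichar_apply {H : Type*} [AddCommGroup H] (M : G →+ AddChar H ℂ) (x : G) (y : H) :
    flipBichar M y x = M x y := rfl

lemma mul_conj_eq_of_bichar [Finite G] (M : G →+ AddChar G ℂ) (h k l : G) :
    M h k * conj (M h l) = M (h + (k + l)) k * conj (M k k) *
      (conj (M (h + (k + l)) l) * M l l * conj ((flipBichar M - M) k l)) := by
  have hne (x y : G) : M x y ≠ 0 := ((M x).val_isUnit y).ne_zero
  simp only [AddMonoidHom.sub_apply, AddChar.sub_apply', flipBichar_apply, map_add,
    AddChar.add_apply, map_mul, map_div₀, ← AddChar.inv_apply_eq_conj]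
  field_simp [hne]

lemma addChar_nsmul_eq_self {m : ℕ} (hm : ∀ x : G, m • x = x) (ψ : AddChar G ℂ) : m • ψ = ψ := by
  ext x
  rw [AddChar.nsmul_apply, ← AddChar.map_nsmul_eq_pow, hm]

variable [Fintype G]

lemma card_range_mul_expect_le {A : Type*} [AddCommGroup A] [Fintype A] (D : G →+ A) {g : A → ℝ}
    (hg : ∀ a, 0 ≤ g a) : Nat.card D.range * 𝔼 x, g (D x) ≤ ∑ a, g a := by
  classical
  have htranslate (v : D.range) : 𝔼 x, g (D x + v) = 𝔼 x, g (D x) := by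
    obtain ⟨_, y, rfl⟩ := v
    simpa only [map_add] using expect_comp_add_right (fun x => g (D x)) y
  calc Nat.card D.range * 𝔼 x, g (D x) = ∑ v : D.range, 𝔼 x, g (D x + v) := by
        simp_rw [htranslate]
        rw [sum_const, card_univ, nsmul_eq_mul, Nat.card_eq_fintype_card]
    _ = 𝔼 x, ∑ v : D.range, g (D x + v) := (expect_sum_comm _ _ _).symm
    _ ≤ ∑ a, g a := by
        let shift (x : G) : D.range ↪ A :=
          (Function.Embedding.subtype _).trans (addLeftEmbedding (D x))
        exact expect_le univ_nonempty fun x _ =>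
          (sum_map univ (shift x) g).symm.trans_le (sum_le_univ_sum_of_nonneg hg)

lemma exists_le_expect_norm_sq_charCoeff_of_correlation (M : G →+ AddChar G ℂ) {p q w : G → ℂ}
    (hp : ∀ x, ‖p x‖ ≤ 1) (hq : ∀ x, ‖q x‖ ≤ 1) (hw : ∀ x, ‖w x‖ ≤ 1) :
    ∃ β : G → ℂ, (∀ x, ‖β x‖ ≤ 1) ∧ ‖𝔼 h, p h * 𝔼 k, q k * w (h + k) * conj (M h k)‖ ^ 4 ≤
      𝔼 k, ‖charCoeff β ((flipBichar M - M) k)‖ ^ 2 := by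
  let α (t k : G) : ℂ := conj (q k) * w (t - k) * (M t k * conj (M k k))
  let β (t l : G) : ℂ := q l * conj (w (t - l)) * (conj (M t l) * M l l)
  have hα (t k : G) : ‖α t k‖ ≤ 1 := by
    simpa only [α, norm_mul, RCLike.norm_conj, AddChar.norm_apply, mul_one] using
      mul_le_one₀ (hq k) (norm_nonneg _) (hw (t - k))
  have hβ (t l : G) : ‖β t l‖ ≤ 1 := by
    simpa only [β, norm_mul, RCLike.norm_conj, AddChar.norm_apply, mul_one] using
      mul_le_one₀ (hq l) (norm_nonneg _) (hw (t - l))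
  have hexpand : ((𝔼 h, ‖𝔼 k, q k * w (h + k) * conj (M h k)‖ ^ 2 : ℝ) : ℂ) =
      𝔼 t, 𝔼 k, α t k * charCoeff (β t) ((flipBichar M - M) k) := by
    have hrotate (F : G → G → G → ℂ) : 𝔼 t, 𝔼 k, 𝔼 l, F t k l = 𝔼 k, 𝔼 l, 𝔼 t, F t k l :=
      (expect_comm _ _ _).trans (expect_congr rfl fun k _ => expect_comm _ _ _)
    simp_rw [Complex.ofReal_expect, Complex.ofReal_pow, ← Complex.conj_mul', map_expect,
      expect_mul_expect, charCoeff, mul_expect]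
    refine (hrotate _).trans (Eq.trans ?_ (hrotate _).symm)
    refine expect_congr rfl fun k _ => expect_congr rfl fun l _ =>
      Fintype.expect_equiv (Equiv.addRight (k + l)) _ _ fun h => ?_
    simp only [Equiv.coe_addRight, α, β, map_mul, Complex.conj_conj]
    rw [show h + (k + l) - k = h + l by abel, show h + (k + l) - l = h + k by abel]
    linear_combination conj (q k) * conj (w (h + k)) * q l * w (h + l) *
      mul_conj_eq_of_bichar M h k l
  have hsquare : ‖𝔼 h, p h * 𝔼 k, q k * w (h + k) * conj (M h k)‖ ^ 2 ≤
      𝔼 t, ‖𝔼 k, α t k * charCoeff (β t) ((flipBichar M - M) k)‖ := by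
    refine (norm_expect_mul_sq_le hp _).trans ?_
    rw [← Complex.norm_of_nonneg (expect_nonneg fun _ _ => by positivity), hexpand]
    exact RCLike.norm_expect_le (K := ℂ)
  obtain ⟨t, -, ht⟩ := exists_le_of_le_expect univ_nonempty hsquare
  refine ⟨β t, hβ t, ?_⟩
  calc ‖𝔼 h, p h * 𝔼 k, q k * w (h + k) * conj (M h k)‖ ^ 4
      = (‖𝔼 h, p h * 𝔼 k, q k * w (h + k) * conj (M h k)‖ ^ 2) ^ 2 := by rw [← pow_mul]
    _ ≤ ‖𝔼 k, α t k * charCoeff (β t) ((flipBichar M - M) k)‖ ^ 2 := by gcongr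
    _ ≤ 𝔼 k, ‖charCoeff (β t) ((flipBichar M - M) k)‖ ^ 2 := norm_expect_mul_sq_le (hα t) _

lemma correlation_pow_four_mul_card_range_le_one (M : G →+ AddChar G ℂ) {p q w : G → ℂ}
    (hp : ∀ x, ‖p x‖ ≤ 1) (hq : ∀ x, ‖q x‖ ≤ 1) (hw : ∀ x, ‖w x‖ ≤ 1) :
    ‖𝔼 h, p h * 𝔼 k, q k * w (h + k) * conj (M h k)‖ ^ 4 *
      Nat.card (flipBichar M - M).range ≤ 1 := by
  obtain ⟨β, hβ, hcorr⟩ := exists_le_expect_norm_sq_charCoeff_of_correlation M hp hq hw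
  rw [mul_comm]
  refine (mul_le_mul_of_nonneg_left hcorr (Nat.cast_nonneg _)).trans ?_
  exact (card_range_mul_expect_le (flipBichar M - M) fun _ => by positivity).trans
    (sum_norm_sq_charCoeff_le_one hβ)

lemma expect_norm_sq_charCoeff_mulDeriv (f : G → ℂ) (φ : G → AddChar G ℂ) :
    ((𝔼 h, ‖charCoeff (mulDeriv f h) (φ h)‖ ^ 2 : ℝ) : ℂ) =
      𝔼 x, 𝔼 h, 𝔼 k, f x * conj (f (x + h)) * conj (f (x + k)) * f (x + h + k) * conj (φ h k) := by
  rw [Complex.ofReal_expect, expect_comm]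
  simp_rw [norm_sq_charCoeff, mulDeriv_mulDeriv]

variable {f : G → ℂ}

lemma pow_four_mul_card_range_antisymm_le_one (hf : ∀ x, ‖f x‖ ≤ 1) (M : G →+ AddChar G ℂ)
    (b : AddChar G ℂ) {c : ℝ} (hc : 0 ≤ c)
    (hM : c ≤ 𝔼 h, ‖charCoeff (mulDeriv f h) (M h + b)‖ ^ 2) :
    c ^ 4 * Nat.card (flipBichar M - M).range ≤ 1 := by
  have hconj (x : G) : ‖conj (f x)‖ ≤ 1 := (RCLike.norm_conj _).trans_le (hf x)
  have hb (k : G) : ‖conj (b k)‖ ≤ 1 := by rw [RCLike.norm_conj, AddChar.norm_apply]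
  let F (x : G) : ℂ := 𝔼 h, f x * conj (f (x + h)) *
    𝔼 k, conj (f (x + k)) * conj (b k) * f (x + (h + k)) * conj (M h k)
  have hF : c ≤ 𝔼 x, ‖F x‖ := by
    refine hM.trans ?_
    rw [← Complex.norm_of_nonneg (expect_nonneg fun _ _ => by positivity),
      expect_norm_sq_charCoeff_mulDeriv]
    refine le_of_eq_of_le (congrArg _ ?_) (RCLike.norm_expect_le (K := ℂ))
    refine expect_congr rfl fun x _ => expect_congr rfl fun h _ => ?_
    rw [mul_expect]
    refine expect_congr rfl fun k _ => ?_
    rw [AddChar.add_apply, map_mul, add_assoc]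
    ring
  obtain ⟨x, -, hx⟩ := exists_le_of_le_expect univ_nonempty hF
  have hrange : ‖F x‖ ^ 4 * Nat.card (flipBichar M - M).range ≤ 1 :=
    correlation_pow_four_mul_card_range_le_one M (p := fun h => f x * conj (f (x + h)))
      (q := fun k => conj (f (x + k)) * conj (b k)) (w := fun y => f (x + y))
      (fun h => norm_mul_le_one (hf x) (hconj (x + h)))
      (fun k => norm_mul_le_one (hconj (x + k)) (hb k)) fun y => hf (x + y)
  exact (mul_le_mul_of_nonneg_right (pow_le_pow_left₀ hc hx 4) (Nat.cast_nonneg _)).trans hrange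

lemma exists_expect_comp_le_card_mul_expect {α R : Type*} [Fintype α] [Finite R] [Nonempty R]
    (r : α → R) {F : α → R → ℝ} (hF : ∀ x v, 0 ≤ F x v) :
    ∃ v, 𝔼 x, F x (r x) ≤ Nat.card R * 𝔼 x, F x v := by
  have := Fintype.ofFinite R
  obtain ⟨v, hv⟩ := Finite.exists_max fun v => 𝔼 x, F x v
  refine ⟨v, ?_⟩
  calc 𝔼 x, F x (r x) ≤ 𝔼 x, ∑ v, F x v :=
        expect_le_expect fun x _ => single_le_sum (fun v _ => hF x v) (mem_univ (r x))
    _ = ∑ v, 𝔼 x, F x v := expect_sum_comm _ _ _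
    _ ≤ Nat.card R * 𝔼 x, F x v := by
        rw [← nsmul_eq_mul, Nat.card_eq_fintype_card]
        exact sum_le_card_nsmul _ _ _ fun w _ => hv w

lemma exists_symm_pow_five_le (hf : ∀ x, ‖f x‖ ≤ 1) {m : ℕ} (hm : ∀ x : G, (2 * m) • x = x)
    (M : G →+ AddChar G ℂ) (b : AddChar G ℂ) {c : ℝ} (hc : 0 ≤ c)
    (hcM : c ≤ 𝔼 h, ‖charCoeff (mulDeriv f h) (M h + b)‖ ^ 2) :
    ∃ (S : G →+ AddChar G ℂ) (b' : AddChar G ℂ), (∀ x y, S x y = S y x) ∧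
      c ^ 5 ≤ 𝔼 h, ‖charCoeff (mulDeriv f h) (S h + b')‖ ^ 2 := by
  let D := flipBichar M - M
  let S : G →+ AddChar G ℂ := m • (M + flipBichar M)
  have hS (x y : G) : S x y = S y x := by
    simp only [S, AddMonoidHom.smul_apply, AddMonoidHom.add_apply, AddChar.nsmul_apply,
      AddChar.add_apply, flipBichar_apply, mul_comm]
  have hM (h : G) : M h + b = S h + (b + D (-(m • h))) := by
    have hsplit : M h = S h + D (-(m • h)) := by
      simp only [S, D, AddMonoidHom.smul_apply, AddMonoidHom.add_apply, AddMonoidHom.sub_apply,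
        map_neg, map_nsmul]
      conv_lhs => rw [← addChar_nsmul_eq_self hm (M h)]
      module
    rw [hsplit]
    abel
  have hD : c ^ 4 * Nat.card D.range ≤ 1 := pow_four_mul_card_range_antisymm_le_one hf M b hc hcM
  obtain ⟨v, hv⟩ := exists_expect_comp_le_card_mul_expect (fun h => D.rangeRestrict (-(m • h)))
    (F := fun h v => ‖charCoeff (mulDeriv f h) (S h + (b + v))‖ ^ 2) fun _ _ => sq_nonneg _
  simp only [AddMonoidHom.coe_rangeRestrict, ← hM] at hv
  refine ⟨S, b + v, hS, ?_⟩
  set σ := 𝔼 h, ‖charCoeff (mulDeriv f h) (S h + (b + v))‖ ^ 2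
  have hσ : 0 ≤ σ := expect_nonneg fun _ _ => sq_nonneg _
  calc c ^ 5 = c ^ 4 * c := pow_succ c 4
    _ ≤ c ^ 4 * (Nat.card D.range * σ) := by gcongr; exact hcM.trans hv
    _ = c ^ 4 * Nat.card D.range * σ := (mul_assoc _ _ _).symm
    _ ≤ σ := mul_le_of_le_one_left hσ hD

end Symmetry

section Integration

universe u

variable {G : Type*} [AddCommGroup G]

lemma bichar_sq_eq_of_symm [Finite G] {Q : G →+ AddChar G ℂ} (hQ : ∀ x y, Q x y = Q y x)
    (x h k : G) :
    Q h k ^ 2 = Q x x * conj (Q (x + h) (x + h)) * conj (Q (x + k) (x + k)) *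
      Q (x + h + k) (x + h + k) := by
  have hne (x y : G) : Q x y ≠ 0 := ((Q x).val_isUnit y).ne_zero
  simp only [map_add, AddChar.add_apply, AddChar.map_add_eq_mul, map_mul,
    ← AddChar.inv_apply_eq_conj]
  field_simp [hne]
  exact hQ h k

variable [Fintype G]

lemma exists_expect_norm_sq_charCoeff_mulDeriv_le {f : G → ℂ} (hf : ∀ x, ‖f x‖ ≤ 1) {m : ℕ}
    (hm : ∀ x : G, (2 * m) • x = x) {S : G →+ AddChar G ℂ} (hS : ∀ x y, S x y = S y x)
    (b : AddChar G ℂ) :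
    ∃ (M : G →+ AddChar G ℂ) (ψ : AddChar G ℂ),
      𝔼 h, ‖charCoeff (mulDeriv f h) (S h + b)‖ ^ 2 ≤ ‖𝔼 x, f x * (M x x * ψ x)‖ := by
  let Q : G →+ AddChar G ℂ := m • S
  have hQsymm (x y : G) : Q x y = Q y x := by
    simp only [Q, AddMonoidHom.smul_apply, AddChar.nsmul_apply, hS x y]
  have hQS (h k : G) : S h k = Q h k ^ 2 := by
    rw [← AddChar.nsmul_apply]
    conv_lhs => rw [← addChar_nsmul_eq_self hm (S h), mul_nsmul']
    rfl
  have hbox (x h k : G) :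
      f x * conj (f (x + h)) * conj (f (x + k)) * f (x + h + k) * conj ((S h + b) k) =
        (f x * conj (Q x x)) * (conj (f (x + h)) * (Q (x + h) (x + h) * b (x + h))) *
          (conj (f (x + k)) * Q (x + k) (x + k)) *
          (f (x + h + k) * (conj (Q (x + h + k) (x + h + k)) * conj (b (x + h + k)))) := by
    have hb : conj (b k) = b (x + h) * conj (b (x + h + k)) := by
      rw [AddChar.map_add_eq_mul b (x + h), map_mul, ← AddChar.inv_apply_eq_conj b (x + h),
        mul_inv_cancel_left₀ (b.val_isUnit (x + h)).ne_zero]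
    rw [AddChar.add_apply, map_mul, hb, hQS, bichar_sq_eq_of_symm hQsymm x h k]
    simp only [map_mul, Complex.conj_conj]
    ring
  have h₁ (x : G) : ‖f x * conj (Q x x)‖ ≤ 1 := by
    simpa only [norm_mul, RCLike.norm_conj, AddChar.norm_apply, mul_one] using hf x
  have h₂ (x : G) : ‖conj (f x) * (Q x x * b x)‖ ≤ 1 := by
    simpa only [norm_mul, RCLike.norm_conj, AddChar.norm_apply, mul_one] using hf x
  have h₃ (x : G) : ‖conj (f x) * Q x x‖ ≤ 1 := by
    simpa only [norm_mul, RCLike.norm_conj, AddChar.norm_apply, mul_one] using hf x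
  obtain ⟨ψ, hψ⟩ :=
    exists_norm_box_le_norm_charCoeff (fun x => f x * (conj (Q x x) * conj (b x))) h₁ h₂ h₃
  refine ⟨-Q, -(b + ψ), ?_⟩
  rw [← Complex.norm_of_nonneg (expect_nonneg fun _ _ => sq_nonneg _),
    expect_norm_sq_charCoeff_mulDeriv]
  simp_rw [hbox]
  refine hψ.trans_eq (congrArg _ (expect_congr rfl fun x _ => ?_))
  simp only [AddMonoidHom.neg_apply, AddChar.neg_apply, AddChar.map_neg_eq_conj,
    AddChar.add_apply, map_mul, mul_assoc]

theorem mainTheorem2_general (p : ℕ) [Fact p.Prime] (hp : p ≠ 2) {δ : ℝ} (hδ : 0 < δ) :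
    ∃ c : ℝ, 0 < c ∧ ∀ (V : Type u) [AddCommGroup V] [Module (ZMod p) V] [Fintype V] (f : V → ℂ),
      (∀ x, ‖f x‖ ≤ 1) → δ ≤ ‖complexCubeAverage f‖ →
        ∃ (M : V →+ AddChar V ℂ) (ψ : AddChar V ℂ), c ≤ ‖𝔼 x, f x * (M x x * ψ x)‖ := by
  obtain ⟨c, hc, haffine⟩ := exists_addMonoidHom_le_expect_norm_sq_charCoeff_mulDeriv.{u} p
    (c₀ := δ ^ 2 / 2) (by positivity)
  refine ⟨c ^ 5, by positivity, fun V _ _ _ f hf hU => ?_⟩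
  have hhalf (x : V) : (2 * ((p + 1) / 2)) • x = x := by
    have hodd : 2 * ((p + 1) / 2) = p + 1 :=
      Nat.mul_div_cancel' ((Fact.out : p.Prime).odd_of_ne_two hp).add_one.two_dvd
    rw [hodd, succ_nsmul, ZModModule.char_nsmul_eq_zero, zero_add]
  obtain ⟨φ, hφ⟩ := exists_norm_complexCubeAverage_sq_le hf
  have hderiv : 2 * (δ ^ 2 / 2) ≤ 𝔼 h, ‖charCoeff (mulDeriv f h) (φ h)‖ ^ 2 := by
    rw [mul_div_cancel₀ _ two_ne_zero]
    exact (pow_le_pow_left₀ hδ.le hU 2).trans hφ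
  obtain ⟨M, b, hMb⟩ := haffine hf φ hderiv
  obtain ⟨S, b', hS, hSb⟩ := exists_symm_pow_five_le hf hhalf M b hc.le hMb
  obtain ⟨Q, ψ, hQ⟩ := exists_expect_norm_sq_charCoeff_mulDeriv_le hf hhalf hS b'
  exact ⟨Q, ψ, hSb.trans hQ⟩

end Integration

section Coordinates

variable {N : ℕ} [NeZero N] {ι : Type*} [Fintype ι]

/-- The character `x ↦ ω ^ (r ⬝ᵥ x)` of `ι → ZMod N`, where `ω = exp (2πi/N)`, as a function of its
frequency `r`. -/
noncomputable def dotProductChar : (ι → ZMod N) →+ AddChar (ι → ZMod N) ℂ where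
  toFun r :=
    { toFun x := ZMod.stdAddChar (r ⬝ᵥ x)
      map_zero_eq_one' := by rw [dotProduct_zero, AddChar.map_zero_eq_one]
      map_add_eq_mul' x y := by rw [dotProduct_add, AddChar.map_add_eq_mul] }
  map_zero' := by
    ext x
    exact (congrArg (ZMod.stdAddChar (N := N)) (zero_dotProduct x)).trans
      (AddChar.map_zero_eq_one _)
  map_add' r s := by
    ext x
    exact (congrArg (ZMod.stdAddChar (N := N)) (add_dotProduct r s x)).trans
      (AddChar.map_add_eq_mul _ _ _)

lemma dotProductChar_apply (r x : ι → ZMod N) :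
    dotProductChar r x = ZMod.stdAddChar (r ⬝ᵥ x) := rfl

lemma dotProductChar_bijective :
    Function.Bijective (dotProductChar : (ι → ZMod N) →+ AddChar (ι → ZMod N) ℂ) := by
  classical
  refine (Fintype.bijective_iff_injective_and_card _).2
    ⟨(injective_iff_map_eq_zero _).2 fun r hr => funext fun i => ?_, AddChar.card_eq.symm⟩
  have hri : dotProductChar r (Pi.single i 1) = 1 := by rw [hr, AddChar.zero_apply]
  rw [dotProductChar_apply, dotProduct_single_one] at hri
  exact ZMod.injective_stdAddChar (hri.trans (AddChar.map_zero_eq_one _).symm)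

lemma exists_matrix_apply_self_eq (M : (ι → ZMod N) →+ AddChar (ι → ZMod N) ℂ) :
    ∃ A : Matrix ι ι (ZMod N), ∀ x, M x x = ZMod.stdAddChar (x ⬝ᵥ (A *ᵥ x)) := by
  classical
  let e := AddEquiv.ofBijective _ (dotProductChar_bijective (N := N) (ι := ι))
  let L := (e.symm.toAddMonoidHom.comp M).toZModLinearMap N
  refine ⟨L.toMatrix', fun x => ?_⟩
  have hL : dotProductChar (L x) = M x := e.apply_symm_apply (M x)
  rw [L.toMatrix'_mulVec, dotProduct_comm, ← dotProductChar_apply, hL]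

lemma exists_quadraticPhase_eq {n : ℕ} (M : (Fin n → ZMod 5) →+ AddChar (Fin n → ZMod 5) ℂ)
    (ψ : AddChar (Fin n → ZMod 5) ℂ) :
    ∃ (A : Matrix (Fin n) (Fin n) (ZMod 5)) (r : Fin n → ZMod 5),
      ∀ x, quadraticPhase A r x = M x x * ψ x := by
  obtain ⟨A, hA⟩ := exists_matrix_apply_self_eq M
  obtain ⟨r, rfl⟩ := dotProductChar_bijective.surjective ψ
  exact ⟨A, r, fun x => by
    rw [quadraticPhase, AddChar.map_add_eq_mul, hA, dotProductChar_apply]⟩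

end Coordinates

theorem mainTheorem2 (δ : ℝ) (hδ : 0 < δ) :
    ∃ c : ℝ, 0 < c ∧
      ∀ (n : ℕ) (f : (Fin n → ZMod 5) → ℝ),
        (∀ x, f x ∈ Set.Icc (-1 : ℝ) 1) → δ ≤ gowersU3Norm f →
          ∃ (M : Matrix (Fin n) (Fin n) (ZMod 5)) (r : Fin n → ZMod 5),
            c ≤ ‖𝔼 x : Fin n → ZMod 5, (f x : ℂ) * quadraticPhase M r x‖ := by
  have : Fact (Nat.Prime 5) := ⟨Nat.prime_five⟩
  obtain ⟨c, hc, hgeneral⟩ := mainTheorem2_general 5 (by norm_num) (pow_pos hδ 8)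
  refine ⟨c, hc, fun n f hf hU => ?_⟩
  have hnorm (x : Fin n → ZMod 5) : ‖(f x : ℂ)‖ ≤ 1 := by
    rw [Complex.norm_real]
    exact abs_le.2 (hf x)
  have hcube : δ ^ 8 ≤ ‖complexCubeAverage fun x => (f x : ℂ)‖ := by
    rw [complexCubeAverage_ofReal, Complex.norm_of_nonneg (cubeAverage_nonneg f),
      ← gowersU3Norm_pow_eight]
    exact pow_le_pow_left₀ hδ.le hU 8
  obtain ⟨Q, ψ, hQ⟩ := hgeneral (Fin n → ZMod 5) (fun x => (f x : ℂ)) hnorm hcube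
  obtain ⟨M, r, hMr⟩ := exists_quadraticPhase_eq Q ψ
  exact ⟨M, r, by simpa only [hMr] using hQ⟩
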